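/- Fix a constant $\delta$ with $0<\delta<1/e$. Consider a single-hop radio network of $n$ stations with time divided into communication steps. A set of $k$ of the stations is activated simultaneously, each holding one message; the other stations never transmit. If exactly one station transmits in a step, its message is delivered and this station becomes idle (it transmits no more); if no station or at least two stations transmit in a step, nothing is delivered. Static $k$-selection is solved when each of the $k$ activated stations has delivered its message. In the protocol Exp Back-on/Back-off the windows are given by the following loop: for $i=1,2,3,\dots$, set $w\leftarrow 2^i$, and while $w\ge 1$, use a window consisting of the next $\lfloor w\rfloor$ steps and then set $w\leftarrow(1-\delta)w$. In each window, every station that is still active chooses one step of the window uniformly at random, independently of all other choices, and transmits in that step. Then there are a constant $c>0$ and an integer $K$ (which may depend on $\delta$) such that for all $k\ge K$, every $n$ and every set of $k$ activated stations, Exp Back-on/Back-off solves static $k$-selection within $4(1+1/\delta)k$ steps with probability at least $1-1/k^c$. -/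

import Mathlib

namespace ExpBackoff

/-- One update of the loop variables `(i, w)` of the protocol: `w ← w * (1 - δ)` as long as
this is at least `1`; otherwise the inner loop ends, `i ← i + 1`, and the window restarts
at `2 ^ i`. -/
noncomputable def nextState (δ : ℝ) (s : ℕ × ℝ) : ℕ × ℝ :=
  open Classical in
  if 1 ≤ s.2 * (1 - δ) then (s.1, s.2 * (1 - δ)) else (s.1 + 1, 2 ^ (s.1 + 1))

/-- The values `(i, w)` of the loop variables in round `r = 0, 1, 2, …`, where a round is one
iteration of the inner loop; the first round has `i = 1` and `w = 2 ^ 1`. -/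
noncomputable def loopState (δ : ℝ) (r : ℕ) : ℕ × ℝ :=
  (nextState δ)^[r] (1, 2 ^ 1)

/-- The number of communication steps in the window of round `r`, which is the integer part of
the window size `w`. -/
noncomputable def windowLength (δ : ℝ) (r : ℕ) : ℕ :=
  ⌊(loopState δ r).2⌋₊

theorem one_le_loopState (δ : ℝ) (r : ℕ) : 1 ≤ (loopState δ r).2 := by
  cases r with
  | zero => norm_num [loopState]
  | succ r =>
    rw [loopState, Function.iterate_succ_apply', nextState]
    split_ifs with h
    · exact h
    · exact one_le_pow₀ (by norm_num)

theorem windowLength_pos (δ : ℝ) (r : ℕ) : 0 < windowLength δ r :=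
  Nat.floor_pos.mpr (one_le_loopState δ r)

instance windowLength_neZero (δ : ℝ) (r : ℕ) : NeZero (windowLength δ r) :=
  ⟨(windowLength_pos δ r).ne'⟩

/-- The number of communication steps that precede round `r`. Steps are numbered from `0`, so
round `r` consists of the steps `t` with `roundStart δ r ≤ t < roundStart δ (r + 1)`. -/
noncomputable def roundStart (δ : ℝ) (r : ℕ) : ℕ :=
  ∑ q ∈ Finset.range r, windowLength δ q

/-- The random choices in a network of `n` stations: `ω (v, r)` is the position, within the
window of round `r`, of the step chosen by station `v`. -/
abbrev Choices (δ : ℝ) (n : ℕ) : Type :=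
  (p : Fin n × ℕ) → Fin (windowLength δ p.2)

/-- The law of the random choices: they are independent over all stations and rounds, and each
is uniform over the steps of the window. -/
noncomputable def choiceMeasure (δ : ℝ) (n : ℕ) : MeasureTheory.Measure (Choices δ n) :=
  MeasureTheory.Measure.infinitePi fun p : Fin n × ℕ =>
    (PMF.uniformOfFintype (Fin (windowLength δ p.2))).toMeasure

/-- Step `t` is the step chosen by station `v` in the round to which `t` belongs. -/
def IsChosenStep {δ : ℝ} {n : ℕ} (ω : Choices δ n) (v : Fin n) (t : ℕ) : Prop :=
  ∃ r : ℕ, t = roundStart δ r + (ω (v, r) : ℕ)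

/-- If `S` is the set of active stations at step `t`, the stations that transmit at step `t`. -/
noncomputable def transmitters {δ : ℝ} {n : ℕ} (ω : Choices δ n) (S : Finset (Fin n)) (t : ℕ) :
    Finset (Fin n) :=
  open Classical in S.filter fun v => IsChosenStep ω v t

/-- The stations that are active (still hold a message to deliver) after the first `t` steps,
when the stations in `A` are activated at time `0`. If exactly one station transmits in a step,
its message is delivered and it becomes idle; otherwise no message is delivered. -/
noncomputable def activeAfter {δ : ℝ} {n : ℕ} (A : Finset (Fin n)) (ω : Choices δ n) :
    ℕ → Finset (Fin n)
  | 0 => A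
  | t + 1 =>
    if (transmitters ω (activeAfter A ω t) t).card = 1 then
      activeAfter A ω t \ transmitters ω (activeAfter A ω t) t
    else activeAfter A ω t

/-- Static selection is solved within `T` steps: every station of `A` has delivered its message
after some number `t ≤ T` of steps. -/
def SolvedWithin {δ : ℝ} {n : ℕ} (A : Finset (Fin n)) (ω : Choices δ n) (T : ℝ) : Prop :=
  ∃ t : ℕ, (t : ℝ) ≤ T ∧ activeAfter A ω t = ∅

end ExpBackoff

/-! Call the run of windows starting at size `2 ^ i` stage `i`. The proof needs only the stage whose
first window `W` satisfies `k < W ≤ 2k`, followed by one more window. Window sizes shrink by the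
factor `1 - δ`, so the stage starts within `W / δ` steps and lasts at most `W / δ`. The next window
has `2W ≤ 4k` steps. Together this is at most `4(1 + 1/δ)k`.

Within the stage, the invariant is that at most `w` stations are active when the window has size
`w`. If `m ≤ ⌊w⌋` stations choose, each is alone with probability at least `1/e`, and the number of
lone stations has variance at most `2m` because the indicators are almost uncorrelated. Since `δ <
1/e`, Chebyshev bounds the probability of breaking the invariant in this window by `O(1/w)`
(`measureReal_card_colliding_gt_le`). The active set is a function of earlier choices, hence
independent of the current ones, so these bounds may be summed (`measureReal_round_le`). The sum is
geometric and dominated by the smallest window: getting down to `x` active stations fails with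
probability `O(1/x)` (`measureReal_active_gt_le`).

Chebyshev is too weak for windows of bounded size, so the rest of the stage is ignored. The at most
`x` survivors meet the next window, of more than `2k` steps, where a collision has probability at
most `x² / (2k)`. Taking `x = k^(1/4)` makes the total failure at most `k^(-1/8)` for large `k`. -/

open MeasureTheory ProbabilityTheory

namespace ExpBackoff

/-! ### The window schedule and its timing. -/

section Loop

theorem roundStart_succ (δ : ℝ) (r : ℕ) :
    roundStart δ (r + 1) = roundStart δ r + windowLength δ r :=
  Finset.sum_range_succ _ _

theorem roundStart_mono (δ : ℝ) : Monotone (roundStart δ) :=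
  monotone_nat_of_le_succ fun r => by rw [roundStart_succ]; omega

theorem loopState_succ (δ : ℝ) (r : ℕ) : loopState δ (r + 1) = nextState δ (loopState δ r) :=
  Function.iterate_succ_apply' _ _ _

/-- Inside a stage the window size decreases geometrically. -/
theorem loopState_add {δ : ℝ} {i r : ℕ} (hr : loopState δ r = (i, 2 ^ i)) {m : ℕ}
    (hm : ∀ j ≤ m, 1 ≤ (2 : ℝ) ^ i * (1 - δ) ^ j) :
    loopState δ (r + m) = (i, 2 ^ i * (1 - δ) ^ m) := by
  induction m with
  | zero => simpa using hr
  | succ m ih =>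
    rw [← add_assoc, loopState_succ, ih fun j hj => hm j (by omega), nextState]
    have h := hm (m + 1) le_rfl
    rw [pow_succ, ← mul_assoc] at h
    rw [if_pos h, pow_succ, ← mul_assoc]

theorem exists_stage_end {δ : ℝ} (h0 : 0 < δ) (i : ℕ) :
    ∃ m : ℕ, (∀ j ≤ m, 1 ≤ (2 : ℝ) ^ i * (1 - δ) ^ j) ∧ (2 : ℝ) ^ i * (1 - δ) ^ (m + 1) < 1 := by
  classical
  have hex : ∃ m : ℕ, (2 : ℝ) ^ i * (1 - δ) ^ m < 1 := by
    obtain ⟨m, hm⟩ := exists_pow_lt_of_lt_one (show (0 : ℝ) < (2 ^ i)⁻¹ by positivity)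
      (show 1 - δ < 1 by linarith)
    refine ⟨m, ?_⟩
    calc (2 : ℝ) ^ i * (1 - δ) ^ m < 2 ^ i * (2 ^ i)⁻¹ := by gcongr
      _ = 1 := mul_inv_cancel₀ (by positivity)
  have hpos : Nat.find hex ≠ 0 := by
    intro h
    have := Nat.find_spec hex
    rw [h, pow_zero, mul_one] at this
    exact absurd this (not_lt.mpr (one_le_pow₀ (by norm_num)))
  obtain ⟨m, hm⟩ := Nat.exists_eq_succ_of_ne_zero hpos
  refine ⟨m, fun j hj => not_lt.mp (Nat.find_min hex (by omega)), ?_⟩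
  have := Nat.find_spec hex
  rwa [hm] at this

/-- Geometric sum of the window sizes, after dropping the floors. -/
theorem roundStart_add_le {δ : ℝ} (h0 : 0 < δ) {r m : ℕ} {w : ℝ}
    (h : ∀ j < m, (loopState δ (r + j)).2 = w * (1 - δ) ^ j) :
    (roundStart δ (r + m) : ℝ) ≤ roundStart δ r + w * (1 - (1 - δ) ^ m) / δ := by
  induction m with
  | zero => simp
  | succ m ih =>
    have h1 := ih fun j hj => h j (by omega)
    have h2 : (windowLength δ (r + m) : ℝ) ≤ w * (1 - δ) ^ m := by
      rw [← h m (by omega)]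
      exact Nat.floor_le (zero_le_one.trans (one_le_loopState _ _))
    rw [← add_assoc, roundStart_succ]
    push_cast
    have h3 : w * (1 - (1 - δ) ^ (m + 1)) / δ
        = w * (1 - (1 - δ) ^ m) / δ + w * (1 - δ) ^ m := by
      field_simp
      ring
    linarith

/-- The next stage begins at most `2 ^ i / δ` steps after the beginning of stage `i`. -/
theorem exists_next_stage {δ : ℝ} (h0 : 0 < δ) (h1 : δ < 1) {i r : ℕ}
    (hr : loopState δ r = (i, 2 ^ i)) :
    ∃ m : ℕ, (∀ j ≤ m, 1 ≤ (2 : ℝ) ^ i * (1 - δ) ^ j) ∧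
      (2 : ℝ) ^ i * (1 - δ) ^ (m + 1) < 1 ∧
      loopState δ (r + (m + 1)) = (i + 1, 2 ^ (i + 1)) ∧
      (roundStart δ (r + (m + 1)) : ℝ) ≤ roundStart δ r + 2 ^ i / δ := by
  obtain ⟨m, hm, hm'⟩ := exists_stage_end h0 i
  refine ⟨m, hm, hm', ?_, ?_⟩
  · rw [← add_assoc, loopState_succ, loopState_add hr hm, nextState, if_neg]
    rw [pow_succ, ← mul_assoc] at hm'
    exact not_le.mpr hm'
  · refine (roundStart_add_le (w := 2 ^ i) h0 fun j hj => ?_).trans ?_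
    · rw [loopState_add hr fun l hl => hm l (by omega)]
    · have : (0 : ℝ) ≤ (1 - δ) ^ (m + 1) := pow_nonneg (by linarith) _
      gcongr
      have : (0 : ℝ) < 2 ^ i := by positivity
      nlinarith

/-- Stage `i + 1` begins within `2 ^ (i + 1) / δ` steps. -/
theorem exists_stage_start {δ : ℝ} (h0 : 0 < δ) (h1 : δ < 1) (i : ℕ) :
    ∃ r : ℕ, loopState δ r = (i + 1, 2 ^ (i + 1)) ∧ (roundStart δ r : ℝ) ≤ 2 ^ (i + 1) / δ := by
  induction i with
  | zero =>
    refine ⟨0, rfl, ?_⟩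
    simp only [roundStart, Finset.range_zero, Finset.sum_empty, Nat.cast_zero]
    positivity
  | succ i ih =>
    obtain ⟨r, hr, hle⟩ := ih
    obtain ⟨m, -, -, hs, hle'⟩ := exists_next_stage h0 h1 hr
    refine ⟨_, hs, hle'.trans ?_⟩
    -- The bounds for the start and for the length of stage `i + 1` coincide, so their sum is the
    -- doubled bound required for stage `i + 2`.
    rw [pow_succ _ (i + 1), mul_two, add_div]
    gcongr

end Loop

/-! ### Deterministic dynamics: from single steps to whole windows. -/

section Dynamics

/-- The elements of `S` on which `f` collides with its value at another element of `S`. -/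
def colliding {ι α : Type*} [DecidableEq ι] [DecidableEq α] (S : Finset ι) (f : ι → α) :
    Finset ι :=
  S.filter fun v => ∃ u ∈ S, u ≠ v ∧ f u = f v

theorem mem_colliding {ι α : Type*} [DecidableEq ι] [DecidableEq α] {S : Finset ι} {f : ι → α}
    {v : ι} : v ∈ colliding S f ↔ v ∈ S ∧ ∃ u ∈ S, u ≠ v ∧ f u = f v :=
  Finset.mem_filter

variable {δ : ℝ} {n : ℕ}

/-- The position of the step that station `v` chooses in the window of round `r`. -/
def choice (v : Fin n) (r : ℕ) (ω : Choices δ n) : Fin (windowLength δ r) :=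
  ω (v, r)

/-- Windows of different rounds are disjoint, so only the choice made for round `r` can produce a
step of that round. -/
theorem isChosenStep_iff (ω : Choices δ n) (v : Fin n) {r s : ℕ} (hs : s < windowLength δ r) :
    IsChosenStep ω v (roundStart δ r + s) ↔ (ω (v, r) : ℕ) = s := by
  constructor
  · rintro ⟨q, hq⟩
    have hlt : (ω (v, q) : ℕ) < windowLength δ q := (ω (v, q)).2
    rcases lt_trichotomy q r with h | rfl | h
    · have := roundStart_mono δ (Nat.succ_le_of_lt h)
      rw [Nat.succ_eq_add_one, roundStart_succ] at this
      omega
    · omega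
    · have := roundStart_mono δ (Nat.succ_le_of_lt h)
      rw [Nat.succ_eq_add_one, roundStart_succ] at this
      omega
  · rintro rfl
    exact ⟨r, rfl⟩

theorem activeAfter_succ_subset (A : Finset (Fin n)) (ω : Choices δ n) (t : ℕ) :
    activeAfter A ω (t + 1) ⊆ activeAfter A ω t := by
  rw [activeAfter]
  split_ifs
  · exact Finset.sdiff_subset
  · exact subset_rfl

theorem activeAfter_antitone (A : Finset (Fin n)) (ω : Choices δ n) :
    Antitone (activeAfter A ω) :=
  antitone_nat_of_succ_le (activeAfter_succ_subset A ω)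

theorem activeAfter_subset (A : Finset (Fin n)) (ω : Choices δ n) (t : ℕ) :
    activeAfter A ω t ⊆ A :=
  activeAfter_antitone A ω (Nat.zero_le t)

/-- After `s` steps of round `r`, the stations that are no longer active are those that chose
one of these steps alone. -/
theorem mem_activeAfter_add (A : Finset (Fin n)) (ω : Choices δ n) {r s : ℕ}
    (hs : s ≤ windowLength δ r) (v : Fin n) :
    v ∈ activeAfter A ω (roundStart δ r + s) ↔
      v ∈ activeAfter A ω (roundStart δ r) ∧ ((ω (v, r) : ℕ) < s →
        ∃ u ∈ activeAfter A ω (roundStart δ r), u ≠ v ∧ ω (u, r) = ω (v, r)) := by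
  induction s generalizing v with
  | zero => simp
  | succ s ih =>
    have ih := ih (by omega)
    set B := activeAfter A ω (roundStart δ r) with hB
    -- A station of `B` that chose step `s` cannot have become idle earlier in the round, so the
    -- transmitters can be read off from `B`.
    have htr : ∀ v, v ∈ transmitters ω (activeAfter A ω (roundStart δ r + s))
        (roundStart δ r + s) ↔ v ∈ B ∧ (ω (v, r) : ℕ) = s := by
      classical
      intro v
      rw [transmitters, Finset.mem_filter, isChosenStep_iff ω v (by omega), ih v]
      constructor
      · rintro ⟨⟨h, -⟩, h'⟩
        exact ⟨h, h'⟩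
      · rintro ⟨h, h'⟩
        exact ⟨⟨h, fun hlt => by omega⟩, h'⟩
    rw [← add_assoc, activeAfter]
    split_ifs with hc
    · obtain ⟨x, hx⟩ := Finset.card_eq_one.mp hc
      have hx' : ∀ v, v = x ↔ v ∈ B ∧ (ω (v, r) : ℕ) = s := fun v => by
        rw [← htr, hx, Finset.mem_singleton]
      rw [Finset.mem_sdiff, ih, htr]
      constructor
      · rintro ⟨⟨h, h'⟩, h''⟩
        exact ⟨h, fun hlt => h' (by have : (ω (v, r) : ℕ) ≠ s := fun e => h'' ⟨h, e⟩; omega)⟩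
      · rintro ⟨h, h'⟩
        refine ⟨⟨h, fun hlt => h' (by omega)⟩, ?_⟩
        rintro ⟨-, hvs⟩
        obtain ⟨u, hu, huv, he⟩ := h' (by omega)
        have h1 := (hx' v).mpr ⟨h, hvs⟩
        have h2 := (hx' u).mpr ⟨hu, by rw [he, hvs]⟩
        exact huv (h2.trans h1.symm)
    · rw [ih]
      refine and_congr_right fun h => ⟨fun h' hlt => ?_, fun h' hlt => h' (by omega)⟩
      rcases Nat.lt_succ_iff_lt_or_eq.mp hlt with hlt | heq
      · exact h' hlt
      -- If nobody else in `B` shared this choice, `v` would be the sole transmitter, contradicting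
      -- `hc`.
      · by_contra! hcon
        refine hc (Finset.card_eq_one.mpr ⟨v, ?_⟩)
        ext u
        rw [htr, Finset.mem_singleton]
        constructor
        · rintro ⟨hu, hus⟩
          by_contra huv
          exact hcon u hu huv (Fin.ext (hus.trans heq.symm))
        · rintro rfl
          exact ⟨h, heq⟩

/-- Replaces the step-by-step process by a recursion over rounds; the probabilistic part uses the
dynamics within a window only through this. -/
theorem activeAfter_roundStart_succ (A : Finset (Fin n)) (ω : Choices δ n) (r : ℕ) :
    activeAfter A ω (roundStart δ (r + 1)) =
      colliding (activeAfter A ω (roundStart δ r)) fun v => choice v r ω := by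
  ext v
  rw [roundStart_succ, mem_activeAfter_add A ω le_rfl, mem_colliding]
  exact and_congr_right fun _ => ⟨fun h => h (ω (v, r)).2, fun h _ => h⟩

theorem activeAfter_roundStart_congr (A : Finset (Fin n)) {ω ω' : Choices δ n} {r : ℕ}
    (h : ∀ v, ∀ q < r, ω (v, q) = ω' (v, q)) :
    activeAfter A ω (roundStart δ r) = activeAfter A ω' (roundStart δ r) := by
  induction r with
  | zero => rfl
  | succ r ih =>
    rw [activeAfter_roundStart_succ, activeAfter_roundStart_succ,
      ih fun v q hq => h v q (by omega)]
    simp only [choice, h _ r (Nat.lt_succ_self r)]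

end Dynamics

/-! ### Collisions of independent uniform choices: moments and tail bounds. -/

section UniformChoices

/-- The event that `X v` differs from `X u` for all other `u ∈ S`. -/
def aloneEvent {Ω ι α : Type*} (X : ι → Ω → α) (S : Finset ι) (v : ι) : Set Ω :=
  {ω | ∀ u ∈ S, u ≠ v → X u ω ≠ X v ω}

variable {Ω ι : Type*} {mΩ : MeasurableSpace Ω} {μ : Measure Ω}
  [IsProbabilityMeasure μ] {L : ℕ} {X : ι → Ω → Fin L}

theorem measurableSet_box (hm : ∀ v, Measurable (X v)) (S : Finset ι)
    (t : ι → Finset (Fin L)) : MeasurableSet {ω | ∀ v ∈ S, X v ω ∈ t v} := by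
  have : {ω | ∀ v ∈ S, X v ω ∈ t v} = ⋂ v ∈ S, X v ⁻¹' (t v : Set (Fin L)) := by
    ext ω; simp
  rw [this]
  exact S.measurableSet_biInter fun v _ => hm v (Set.toFinite _).measurableSet

theorem measureReal_box (hX : iIndepFun X μ) (hm : ∀ v, Measurable (X v))
    (hu : ∀ v s, μ.real (X v ⁻¹' {s}) = 1 / L) (S : Finset ι) (t : ι → Finset (Fin L)) :
    μ.real {ω | ∀ v ∈ S, X v ω ∈ t v} = ∏ v ∈ S, ((t v).card : ℝ) / L := by
  have : {ω | ∀ v ∈ S, X v ω ∈ t v} = ⋂ v ∈ S, X v ⁻¹' (t v : Set (Fin L)) := by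
    ext ω; simp
  rw [this, measureReal_def, hX.measure_inter_preimage_eq_mul S
    (fun v _ => (Set.toFinite _).measurableSet), ENNReal.toReal_prod]
  refine Finset.prod_congr rfl fun v _ => ?_
  have h2 : X v ⁻¹' (t v : Set (Fin L)) = ⋃ s ∈ t v, X v ⁻¹' {s} := by
    ext ω; simp
  rw [h2, ← measureReal_def, measureReal_biUnion_finset]
  · simp only [hu, Finset.sum_const, nsmul_eq_mul]
    ring
  · intro s _ s' _ hss
    exact Disjoint.preimage _ (by simpa using hss)
  · exact fun s _ => hm v (measurableSet_singleton s)

theorem measurableSet_aloneEvent (hm : ∀ v, Measurable (X v)) (S : Finset ι) (v : ι) :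
    MeasurableSet (aloneEvent X S v) := by
  have : aloneEvent X S v = ⋂ u ∈ S, {ω | u ≠ v → X u ω ≠ X v ω} := by
    ext ω; simp [aloneEvent]
  rw [this]
  refine S.measurableSet_biInter fun u _ => ?_
  by_cases h : u = v
  · simp [h]
  · simp only [ne_eq, h, not_false_eq_true, forall_const]
    exact (measurableSet_eq_fun (hm u) (hm v)).compl

variable [DecidableEq ι]

/-- Split by the value `s` of `X v`: the other elements of `S` must all avoid `s`, which gives `L`
disjoint boxes of equal probability. -/
theorem measureReal_aloneEvent (hX : iIndepFun X μ) (hm : ∀ v, Measurable (X v))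
    (hu : ∀ v s, μ.real (X v ⁻¹' {s}) = 1 / L) (hL : 0 < L) {S : Finset ι} {v : ι} (hv : v ∈ S) :
    μ.real (aloneEvent X S v) = (1 - 1 / (L : ℝ)) ^ (S.card - 1) := by
  have hL' : (L : ℝ) ≠ 0 := by positivity
  set t : Fin L → ι → Finset (Fin L) := fun s u => if u = v then {s} else {s}ᶜ with ht
  have hun : aloneEvent X S v = ⋃ s ∈ Finset.univ, {ω | ∀ u ∈ S, X u ω ∈ t s u} := by
    ext ω
    simp only [aloneEvent, Set.mem_ofPred_eq, Set.mem_iUnion, Finset.mem_univ, exists_const]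
    constructor
    · refine fun h => ⟨X v ω, fun u huS => ?_⟩
      by_cases huv : u = v
      · simp [ht, huv]
      · simpa [ht, huv] using h u huS huv
    · rintro ⟨s, hs⟩ u huS huv
      have h1 := hs v hv
      have h2 := hs u huS
      simp only [ht, if_true, if_neg huv, Finset.mem_singleton, Finset.mem_compl] at h1 h2
      rwa [h1]
  rw [hun, measureReal_biUnion_finset]
  · have hbox : ∀ s, μ.real {ω | ∀ u ∈ S, X u ω ∈ t s u}
        = 1 / L * (1 - 1 / (L : ℝ)) ^ (S.card - 1) := by
      intro s
      rw [measureReal_box hX hm hu, ← Finset.mul_prod_erase S _ hv]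
      congr 1
      · simp [ht]
      · rw [← Finset.card_erase_of_mem hv, ← Finset.prod_const]
        refine Finset.prod_congr rfl fun u huS => ?_
        simp only [ht, if_neg (Finset.ne_of_mem_erase huS), Finset.card_compl,
          Finset.card_singleton, Fintype.card_fin]
        rw [Nat.cast_sub hL]
        field_simp
        simp
    simp only [hbox, Finset.sum_const, Finset.card_univ, Fintype.card_fin, nsmul_eq_mul]
    field_simp
  · intro s _ s' _ hss
    rw [Function.onFun, Set.disjoint_left]
    intro ω h h'
    have h1 := h v hv
    have h2 := h' v hv
    simp only [ht, if_true, Finset.mem_singleton] at h1 h2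
    exact hss (h1.symm.trans h2)
  · exact fun s _ => measurableSet_box hm S _

/-- Split by the `L(L - 1)` pairs of distinct values at `v` and `w`; each other element avoids both
with probability `1 - 2/L ≤ (1 - 1/L)²`. The bound is left in powers of `1 - 1/L` so that it
compares directly with the product of the two marginals. -/
theorem measureReal_aloneEvent_inter_le (hX : iIndepFun X μ) (hm : ∀ v, Measurable (X v))
    (hu : ∀ v s, μ.real (X v ⁻¹' {s}) = 1 / L) (hL : 0 < L) {S : Finset ι} {v w : ι}
    (hv : v ∈ S) (hw : w ∈ S) (hvw : v ≠ w) :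
    μ.real (aloneEvent X S v ∩ aloneEvent X S w) ≤
      (1 - 1 / (L : ℝ)) * ((1 - 1 / (L : ℝ)) ^ 2) ^ (S.card - 2) := by
  have hL' : (L : ℝ) ≠ 0 := by positivity
  set t : Fin L × Fin L → ι → Finset (Fin L) := fun p u =>
    if u = v then {p.1} else if u = w then {p.2} else {p.1, p.2}ᶜ with ht
  have hun : aloneEvent X S v ∩ aloneEvent X S w ⊆
      ⋃ p ∈ (Finset.univ : Finset (Fin L)).offDiag, {ω | ∀ u ∈ S, X u ω ∈ t p u} := by
    rintro ω ⟨h1, h2⟩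
    simp only [Set.mem_iUnion, exists_prop]
    refine ⟨(X v ω, X w ω), by simpa using h2 v hv hvw, fun u huS => ?_⟩
    by_cases huv : u = v
    · simp [ht, huv]
    · by_cases huw : u = w
      · simp [ht, huw, hvw.symm]
      · simpa [ht, huv, huw] using ⟨h1 u huS huv, h2 u huS huw⟩
  refine (measureReal_mono hun (measure_ne_top _ _)).trans
    ((measureReal_biUnion_finset_le _ _).trans ?_)
  have hbox : ∀ p ∈ (Finset.univ : Finset (Fin L)).offDiag,
      μ.real {ω | ∀ u ∈ S, X u ω ∈ t p u}
        ≤ 1 / L * (1 / L) * ((1 - 1 / (L : ℝ)) ^ 2) ^ (S.card - 2) := by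
    intro p hp
    have hp' : p.1 ≠ p.2 := by simpa using hp
    have hL2 : 2 ≤ L := by
      have h1 := p.1.2
      have h2 := p.2.2
      have h3 : (p.1 : ℕ) ≠ p.2 := fun h => hp' (Fin.ext h)
      omega
    have hw' : w ∈ S.erase v := Finset.mem_erase.mpr ⟨hvw.symm, hw⟩
    rw [measureReal_box hX hm hu, ← Finset.mul_prod_erase S _ hv,
      ← Finset.mul_prod_erase (S.erase v) _ hw', ← mul_assoc]
    have hc : ((S.erase v).erase w).card = S.card - 2 := by
      rw [Finset.card_erase_of_mem hw', Finset.card_erase_of_mem hv]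
      omega
    have e1 : (((t p v).card : ℝ)) = 1 := by simp [ht]
    have e2 : (((t p w).card : ℝ)) = 1 := by simp [ht, hvw.symm]
    rw [e1, e2, ← hc, ← Finset.prod_const]
    gcongr with u huS
    have h1 : u ≠ w := Finset.ne_of_mem_erase huS
    have h2 : u ≠ v := Finset.ne_of_mem_erase (Finset.mem_of_mem_erase huS)
    simp only [ht, if_neg h1, if_neg h2, Finset.card_compl, Finset.card_pair hp',
      Fintype.card_fin]
    rw [Nat.cast_sub hL2, sub_div, div_self hL']
    have : (0 : ℝ) ≤ (1 / L) ^ 2 := by positivity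
    push_cast
    have h3 : (2 : ℝ) / L = 2 * (1 / L) := by ring
    rw [h3]
    nlinarith
  refine (Finset.sum_le_sum hbox).trans (le_of_eq ?_)
  rw [Finset.sum_const, Finset.offDiag_card, Finset.card_univ, Fintype.card_fin, nsmul_eq_mul,
    Nat.cast_sub (Nat.le_mul_self L)]
  push_cast
  field_simp

theorem memLp_indicator_one {s : Set Ω} (hs : MeasurableSet s) :
    MemLp (s.indicator (1 : Ω → ℝ)) 2 μ :=
  (memLp_const (1 : ℝ)).indicator hs

theorem covariance_indicator_one {s t : Set Ω} (hs : MeasurableSet s) (ht : MeasurableSet t) :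
    cov[s.indicator (1 : Ω → ℝ), t.indicator (1 : Ω → ℝ); μ]
      = μ.real (s ∩ t) - μ.real s * μ.real t := by
  rw [covariance_eq_sub (memLp_indicator_one hs) (memLp_indicator_one ht),
    ← Set.inter_indicator_one, integral_indicator_one hs, integral_indicator_one ht,
    integral_indicator_one (hs.inter ht)]

theorem covariance_aloneEvent_le (hX : iIndepFun X μ) (hm : ∀ v, Measurable (X v))
    (hu : ∀ v s, μ.real (X v ⁻¹' {s}) = 1 / L) (hL : 0 < L) {S : Finset ι} {v w : ι}
    (hv : v ∈ S) (hw : w ∈ S) (hvw : v ≠ w) :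
    cov[(aloneEvent X S v).indicator (1 : Ω → ℝ), (aloneEvent X S w).indicator (1 : Ω → ℝ); μ]
      ≤ 1 / L := by
  rw [covariance_indicator_one (measurableSet_aloneEvent hm S v)
    (measurableSet_aloneEvent hm S w), measureReal_aloneEvent hX hm hu hL hv,
    measureReal_aloneEvent hX hm hu hL hw]
  have h := measureReal_aloneEvent_inter_le hX hm hu hL hv hw hvw
  obtain ⟨j, hj⟩ : ∃ j, S.card = j + 2 := by
    have : 1 < S.card := Finset.one_lt_card.mpr ⟨v, hv, w, hw, hvw⟩
    exact ⟨S.card - 2, by omega⟩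
  rw [hj] at h ⊢
  simp only [Nat.add_sub_cancel, Nat.add_succ_sub_one] at h ⊢
  set q : ℝ := 1 - 1 / L with hq
  have hL1 : (1 : ℝ) ≤ L := by exact_mod_cast hL
  have hq1 : q ≤ 1 := by rw [hq]; simp
  have hq0 : 0 ≤ q := by
    rw [hq, sub_nonneg, div_le_one (by linarith)]
    exact hL1
  clear_value q
  -- The joint bound and the product of marginals differ by a single factor `q`, and `1 - q = 1/L`.
  have h1 : q * (q ^ 2) ^ j - q ^ (j + 1) * q ^ (j + 1) = (q * (q ^ 2) ^ j) * (1 / L) := by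
    have : (1 : ℝ) / L = 1 - q := by rw [hq]; ring
    rw [this]
    ring
  have h2 : q * (q ^ 2) ^ j ≤ 1 := mul_le_one₀ hq1 (by positivity)
    (pow_le_one₀ (by positivity) (pow_le_one₀ hq0 hq1))
  have h3 : (q * (q ^ 2) ^ j) * (1 / (L : ℝ)) ≤ 1 / L :=
    mul_le_of_le_one_left (by positivity) h2
  linarith

/-- The number of elements of `S` on which `X` takes a value that it takes nowhere else. -/
noncomputable def aloneCount (X : ι → Ω → Fin L) (S : Finset ι) : Ω → ℝ :=
  ∑ v ∈ S, (aloneEvent X S v).indicator 1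

omit [DecidableEq ι] in
theorem memLp_aloneCount (hm : ∀ v, Measurable (X v)) (S : Finset ι) :
    MemLp (aloneCount X S) 2 μ :=
  memLp_finsetSum' _ fun v _ => memLp_indicator_one (measurableSet_aloneEvent hm S v)

theorem integral_aloneCount (hX : iIndepFun X μ) (hm : ∀ v, Measurable (X v))
    (hu : ∀ v s, μ.real (X v ⁻¹' {s}) = 1 / L) (hL : 0 < L) (S : Finset ι) :
    ∫ ω, aloneCount X S ω ∂μ = S.card * (1 - 1 / (L : ℝ)) ^ (S.card - 1) := by
  simp only [aloneCount, Finset.sum_apply]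
  rw [integral_finsetSum _ fun v _ =>
    (memLp_indicator_one (measurableSet_aloneEvent hm S v)).integrable (by norm_num)]
  rw [Finset.sum_congr rfl fun v hv => (integral_indicator_one
    (measurableSet_aloneEvent hm S v)).trans (measureReal_aloneEvent hX hm hu hL hv)]
  rw [Finset.sum_const, nsmul_eq_mul]

/-- Each row of the covariance matrix sums to at most `2`: the diagonal entry is at most `1`, and
the fewer than `L` other entries are at most `1/L` each. -/
theorem variance_aloneCount_le (hX : iIndepFun X μ) (hm : ∀ v, Measurable (X v))
    (hu : ∀ v s, μ.real (X v ⁻¹' {s}) = 1 / L) (hL : 0 < L) {S : Finset ι} (hS : S.card ≤ L) :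
    Var[aloneCount X S; μ] ≤ 2 * S.card := by
  have hLpos : (0 : ℝ) < L := by exact_mod_cast hL
  rw [aloneCount, variance_sum' fun v _ =>
    memLp_indicator_one (measurableSet_aloneEvent hm S v)]
  have hrow : ∀ v ∈ S, ∑ w ∈ S, cov[(aloneEvent X S v).indicator (1 : Ω → ℝ),
      (aloneEvent X S w).indicator (1 : Ω → ℝ); μ] ≤ 2 := by
    intro v hv
    rw [← Finset.add_sum_erase S _ hv]
    have h1 : cov[(aloneEvent X S v).indicator (1 : Ω → ℝ),
        (aloneEvent X S v).indicator (1 : Ω → ℝ); μ] ≤ 1 := by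
      rw [covariance_indicator_one (measurableSet_aloneEvent hm S v)
        (measurableSet_aloneEvent hm S v)]
      have h2 : μ.real (aloneEvent X S v ∩ aloneEvent X S v) ≤ 1 := measureReal_le_one
      have h3 := mul_self_nonneg (μ.real (aloneEvent X S v))
      linarith
    have h2 : ∑ w ∈ S.erase v, cov[(aloneEvent X S v).indicator (1 : Ω → ℝ),
        (aloneEvent X S w).indicator (1 : Ω → ℝ); μ] ≤ ∑ w ∈ S.erase v, 1 / (L : ℝ) :=
      Finset.sum_le_sum fun w hw => covariance_aloneEvent_le hX hm hu hL hv
        (Finset.mem_of_mem_erase hw) (Finset.ne_of_mem_erase hw).symm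
    have h3 : ∑ w ∈ S.erase v, 1 / (L : ℝ) ≤ 1 := by
      rw [Finset.sum_const, nsmul_eq_mul, mul_one_div, div_le_one hLpos]
      exact_mod_cast (Finset.card_le_card (Finset.erase_subset _ _)).trans hS
    linarith
  calc _ ≤ ∑ v ∈ S, (2 : ℝ) := Finset.sum_le_sum hrow
    _ = 2 * S.card := by rw [Finset.sum_const, nsmul_eq_mul, mul_comm]

theorem card_colliding (S : Finset ι) (ω : Ω) :
    ((colliding S fun v => X v ω).card : ℝ) = S.card - aloneCount X S ω := by
  classical
  have h : aloneCount X S ω = ((S.filter fun v => ω ∈ aloneEvent X S v).card : ℝ) := by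
    simp only [aloneCount, Finset.sum_apply, Set.indicator_apply, Pi.one_apply,
      Finset.sum_boole]
  have h2 : colliding S (fun v => X v ω) = S.filter fun v => ¬ ω ∈ aloneEvent X S v := by
    refine Finset.filter_congr fun v _ => ?_
    simp [aloneEvent]
  rw [h, h2, eq_sub_iff_add_eq, add_comm]
  exact_mod_cast Finset.card_filter_add_card_filter_not (s := S) _

/-- The worst case is `m = L`, where `log q ≥ 1 - 1/q = -1/(L - 1)` for `q = 1 - 1/L`. For `L = 1`
the exponent is `0`. -/
theorem inv_exp_one_le_one_sub_inv_pow {L m : ℕ} (hL : 0 < L) (hm : m ≤ L) :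
    1 / Real.exp 1 ≤ (1 - 1 / (L : ℝ)) ^ (m - 1) := by
  rcases Nat.lt_or_ge 1 L with h | h
  · have hL1 : (1 : ℝ) < L := by exact_mod_cast h
    set q : ℝ := 1 - 1 / L with hq
    have hq1 : q ≤ 1 := by rw [hq]; simp
    have hq0 : 0 < q := by
      rw [hq, sub_pos, div_lt_one (by linarith)]
      exact hL1
    refine le_trans ?_ (pow_le_pow_of_le_one hq0.le hq1 (show m - 1 ≤ L - 1 by omega))
    have hlog := Real.one_sub_inv_le_log_of_pos hq0
    have hq' : 1 - q⁻¹ = - (1 / ((L - 1 : ℕ) : ℝ)) := by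
      have hne : (L : ℝ) - 1 ≠ 0 := by linarith
      have : q = (L - 1) / L := by rw [hq]; field_simp
      rw [this, Nat.cast_sub hL, inv_div]
      push_cast
      field_simp
      ring
    rw [← Real.exp_log hq0, ← Real.exp_nat_mul, one_div, ← Real.exp_neg, Real.exp_le_exp]
    have hpos : (0 : ℝ) < ((L - 1 : ℕ) : ℝ) := by exact_mod_cast (by omega : 0 < L - 1)
    rw [hq'] at hlog
    calc (-1 : ℝ) = ((L - 1 : ℕ) : ℝ) * -(1 / ((L - 1 : ℕ) : ℝ)) := by field_simp
      _ ≤ _ := by gcongr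
  · have : m - 1 = 0 := by omega
    rw [this, pow_zero, div_le_one (Real.exp_pos _)]
    exact Real.one_le_exp (by norm_num)

/-- If at most `w` stations choose among `⌊w⌋` steps, then with high probability at most
`(1 - δ) w` of them collide. -/
theorem measureReal_card_colliding_gt_le (hX : iIndepFun X μ) (hm : ∀ v, Measurable (X v))
    (hu : ∀ v s, μ.real (X v ⁻¹' {s}) = 1 / L) (hL : 0 < L) {S : Finset ι} (hS : S.card ≤ L)
    {δ w : ℝ} (hδ : δ < 1 / Real.exp 1) (hw : L ≤ w) :
    μ.real {ω | w * (1 - δ) < ((colliding S fun v => X v ω).card : ℝ)} ≤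
      2 / (1 / Real.exp 1 - δ) ^ 2 / w := by
  have hε : 0 < 1 / Real.exp 1 - δ := by linarith
  have hwpos : 0 < w := lt_of_lt_of_le (by exact_mod_cast hL) hw
  have hSw : (S.card : ℝ) ≤ w := le_trans (by exact_mod_cast hS) hw
  have hc : 0 < (1 / Real.exp 1 - δ) * w := by positivity
  have hsub : {ω | w * (1 - δ) < ((colliding S fun v => X v ω).card : ℝ)} ⊆
      {ω | (1 / Real.exp 1 - δ) * w ≤ |aloneCount X S ω - ∫ ω, aloneCount X S ω ∂μ|} := by
    intro ω hω
    simp only [Set.mem_ofPred_eq] at hω ⊢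
    rw [card_colliding] at hω
    rw [integral_aloneCount hX hm hu hL]
    refine le_trans ?_ (neg_le_abs _)
    have h1 : (S.card : ℝ) * (1 / Real.exp 1) ≤ S.card * (1 - 1 / (L : ℝ)) ^ (S.card - 1) := by
      gcongr
      exact inv_exp_one_le_one_sub_inv_pow hL hS
    have h2 : 1 / Real.exp 1 ≤ 1 := by
      rw [div_le_one (Real.exp_pos _)]
      exact Real.one_le_exp (by norm_num)
    -- The count falls below its mean by more than `|S|/e - |S| + w(1 - δ) = (1/e - δ)w + (w -
    -- |S|)(1 - 1/e)`, and the last product is nonnegative.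
    nlinarith [mul_nonneg (sub_nonneg.mpr hSw) (sub_nonneg.mpr h2)]
  have hcheb := meas_ge_le_variance_div_sq (μ := μ) (memLp_aloneCount hm S) hc
  have hvar := variance_aloneCount_le hX hm hu hL hS
  calc _ ≤ μ.real {ω | (1 / Real.exp 1 - δ) * w ≤
          |aloneCount X S ω - ∫ ω, aloneCount X S ω ∂μ|} :=
        measureReal_mono hsub (measure_ne_top _ _)
    _ ≤ Var[aloneCount X S; μ] / ((1 / Real.exp 1 - δ) * w) ^ 2 :=
        ENNReal.toReal_le_of_le_ofReal (by have := variance_nonneg (aloneCount X S) μ; positivity)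
          hcheb
    _ ≤ 2 * w / ((1 / Real.exp 1 - δ) * w) ^ 2 := by gcongr; linarith
    _ = _ := by field_simp

/-- Union bound over `S`, with Bernoulli's inequality for each element. -/
theorem measureReal_colliding_nonempty_le (hX : iIndepFun X μ) (hm : ∀ v, Measurable (X v))
    (hu : ∀ v s, μ.real (X v ⁻¹' {s}) = 1 / L) (hL : 0 < L) (S : Finset ι) :
    μ.real {ω | colliding S (fun v => X v ω) ≠ ∅} ≤ (S.card : ℝ) ^ 2 / L := by
  have hL1 : (1 : ℝ) ≤ L := by exact_mod_cast hL
  have hsub : {ω | colliding S (fun v => X v ω) ≠ ∅} ⊆ ⋃ v ∈ S, (aloneEvent X S v)ᶜ := by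
    intro ω hω
    obtain ⟨v, hv⟩ := Finset.nonempty_iff_ne_empty.mpr hω
    rw [mem_colliding] at hv
    simp only [Set.mem_iUnion, exists_prop]
    exact ⟨v, hv.1, by simpa [aloneEvent] using hv.2⟩
  refine (measureReal_mono hsub (measure_ne_top _ _)).trans
    ((measureReal_biUnion_finset_le _ _).trans ?_)
  have h : ∀ v ∈ S, μ.real (aloneEvent X S v)ᶜ ≤ S.card / L := by
    intro v hv
    rw [probReal_compl_eq_one_sub (measurableSet_aloneEvent hm S v),
      measureReal_aloneEvent hX hm hu hL hv]
    have hb : (1 : ℝ) / L ≤ 1 := by rw [div_le_one (by linarith)]; exact hL1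
    have := one_add_mul_le_pow (a := -(1 / (L : ℝ))) (by linarith) (S.card - 1)
    rw [← sub_eq_add_neg] at this
    have h2 : ((S.card - 1 : ℕ) : ℝ) ≤ S.card := by exact_mod_cast Nat.sub_le _ _
    have h3 : ((S.card - 1 : ℕ) : ℝ) * (1 / L) ≤ S.card * (1 / L) := by gcongr
    rw [← mul_one_div (S.card : ℝ)]
    linarith
  refine (Finset.sum_le_sum h).trans (le_of_eq ?_)
  rw [Finset.sum_const, nsmul_eq_mul]
  ring

end UniformChoices

/-! ### Independence between rounds and the failure probability. -/

section ChoiceMeasure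

variable {δ : ℝ} {n : ℕ}

instance isProbabilityMeasure_choiceMeasure : IsProbabilityMeasure (choiceMeasure δ n) := by
  unfold choiceMeasure
  infer_instance

theorem iIndepFun_eval :
    iIndepFun (fun (p : Fin n × ℕ) (ω : Choices δ n) => ω p) (choiceMeasure δ n) :=
  iIndepFun_infinitePi (X := fun _ x => x) fun _ => measurable_id

theorem measurable_choice (v : Fin n) (r : ℕ) :
    Measurable (choice v r : Choices δ n → Fin (windowLength δ r)) :=
  measurable_pi_apply (v, r)

theorem iIndepFun_choice (r : ℕ) :
    iIndepFun (fun (v : Fin n) (ω : Choices δ n) => choice v r ω) (choiceMeasure δ n) :=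
  iIndepFun_eval.precomp (g := fun v => (v, r)) fun _ _ h => (Prod.mk.inj h).1

theorem measureReal_choice (v : Fin n) (r : ℕ) (s : Fin (windowLength δ r)) :
    (choiceMeasure δ n).real (choice v r ⁻¹' {s}) = 1 / windowLength δ r := by
  have h := (measurePreserving_eval_infinitePi (fun p : Fin n × ℕ =>
    (PMF.uniformOfFintype (Fin (windowLength δ p.2))).toMeasure) (v, r)).measure_preimage
    (measurableSet_singleton s).nullMeasurableSet
  rw [PMF.toMeasure_apply_singleton _ _ (measurableSet_singleton s),
    PMF.uniformOfFintype_apply, Fintype.card_fin] at h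
  have h2 : (choice v r : Choices δ n → _) ⁻¹' {s} = Function.eval (β := fun p : Fin n × ℕ => Fin (windowLength δ p.2)) (v, r) ⁻¹' {s} := rfl
  rw [measureReal_def, h2, choiceMeasure, h]
  simp

/-- Finitely many choices range over a finite discrete space, so such an event is measurable, and
independence of coordinates applies to it, whatever `s` is. -/
theorem exists_preimage_restrict {E : Set (Choices δ n)} {F : Finset (Fin n × ℕ)}
    (hE : ∀ ω ω' : Choices δ n, (∀ p ∈ F, ω p = ω' p) → ω ∈ E → ω' ∈ E) :
    ∃ s : Set ((p : F) → Fin (windowLength δ p.1.2)),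
      E = (fun (ω : Choices δ n) (p : F) => ω p) ⁻¹' s := by
  refine ⟨(fun (ω : Choices δ n) (p : F) => ω p) '' E, Set.Subset.antisymm
    (Set.subset_preimage_image _ _) ?_⟩
  rintro ω ⟨ω', h, he⟩
  exact hE ω' ω (fun p hp => congrFun he ⟨p, hp⟩) h

theorem measurableSet_of_finite_dependence {E : Set (Choices δ n)} {F : Finset (Fin n × ℕ)}
    (hE : ∀ ω ω' : Choices δ n, (∀ p ∈ F, ω p = ω' p) → ω ∈ E → ω' ∈ E) :
    MeasurableSet E := by
  obtain ⟨s, rfl⟩ := exists_preimage_restrict hE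
  exact (measurable_pi_lambda _ fun p => measurable_pi_apply p.1) (MeasurableSet.of_discrete)

/-- Events that depend on disjoint finite sets of choices are independent. -/
theorem measureReal_inter_of_finite_dependence {E E' : Set (Choices δ n)}
    {F F' : Finset (Fin n × ℕ)} (hF : Disjoint F F')
    (hE : ∀ ω ω' : Choices δ n, (∀ p ∈ F, ω p = ω' p) → ω ∈ E → ω' ∈ E)
    (hE' : ∀ ω ω' : Choices δ n, (∀ p ∈ F', ω p = ω' p) → ω ∈ E' → ω' ∈ E') :
    (choiceMeasure δ n).real (E ∩ E') =
      (choiceMeasure δ n).real E * (choiceMeasure δ n).real E' := by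
  obtain ⟨s, rfl⟩ := exists_preimage_restrict hE
  obtain ⟨s', rfl⟩ := exists_preimage_restrict hE'
  have h := (iIndepFun_eval (δ := δ) (n := n)).indepFun_finset F F' hF
    fun p => measurable_pi_apply p
  rw [measureReal_def, h.measure_inter_preimage_eq_mul s s' (MeasurableSet.of_discrete)
    (MeasurableSet.of_discrete), ENNReal.toReal_mul]
  rfl

theorem activeAfter_roundStart_dependence (A S : Finset (Fin n)) (r : ℕ) (ω ω' : Choices δ n)
    (h : ∀ p ∈ (Finset.univ : Finset (Fin n)) ×ˢ Finset.range r, ω p = ω' p)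
    (hω : ω ∈ {ω | activeAfter A ω (roundStart δ r) = S}) :
    ω' ∈ {ω | activeAfter A ω (roundStart δ r) = S} := by
  rw [Set.mem_ofPred_eq] at hω ⊢
  rw [← hω]
  exact (activeAfter_roundStart_congr A fun v q hq => h (v, q) (by simpa using hq)).symm

/-- If the stations `S` that are active at the beginning of round `r` satisfy `P`, and for every
such `S` the stations colliding in round `r` satisfy `Q` with probability at most `p`, then
these two happen with probability at most `p`. -/
theorem measureReal_round_le (A : Finset (Fin n)) (r : ℕ) (P Q : Finset (Fin n) → Prop) {p : ℝ}
    (hp : 0 ≤ p)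
    (h : ∀ S, P S → (choiceMeasure δ n).real {ω | Q (colliding S fun v => choice v r ω)} ≤ p) :
    (choiceMeasure δ n).real {ω | P (activeAfter A ω (roundStart δ r)) ∧
      Q (activeAfter A ω (roundStart δ (r + 1)))} ≤ p := by
  classical
  -- Conditioning on the active set: `E S` depends only on rounds before `r`, `D S` only on round
  -- `r`, and the events `E S` are disjoint.
  set E : Finset (Fin n) → Set (Choices δ n) := fun S =>
    {ω | activeAfter A ω (roundStart δ r) = S} with hE
  set D : Finset (Fin n) → Set (Choices δ n) := fun S =>
    {ω | Q (colliding S fun v => choice v r ω)} with hD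
  have hsub : {ω | P (activeAfter A ω (roundStart δ r)) ∧
      Q (activeAfter A ω (roundStart δ (r + 1)))} ⊆
      ⋃ S ∈ Finset.univ.filter P, E S ∩ D S := by
    rintro ω ⟨h1, h2⟩
    rw [activeAfter_roundStart_succ] at h2
    simp only [Set.mem_iUnion, Finset.mem_filter, Finset.mem_univ, true_and, exists_prop]
    exact ⟨_, h1, rfl, h2⟩
  have hmul : ∀ S, (choiceMeasure δ n).real (E S ∩ D S) =
      (choiceMeasure δ n).real (E S) * (choiceMeasure δ n).real (D S) := by
    intro S
    refine measureReal_inter_of_finite_dependence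
      (F' := (Finset.univ : Finset (Fin n)) ×ˢ {r}) ?_
      (activeAfter_roundStart_dependence A S r) ?_
    · rw [Finset.disjoint_left]
      intro q hq hq'
      simp only [Finset.mem_product, Finset.mem_univ, true_and, Finset.mem_range,
        Finset.mem_singleton] at hq hq'
      omega
    · intro ω ω' hωω hω
      have : (fun v => choice v r ω') = fun v => choice v r ω :=
        funext fun v => (hωω (v, r) (by simp)).symm
      simp only [hD, Set.mem_ofPred_eq] at hω ⊢
      rwa [this]
  have hmeas : ∀ S, MeasurableSet (E S) := fun S =>
    measurableSet_of_finite_dependence (activeAfter_roundStart_dependence A S r)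
  have hone : ∑ S ∈ Finset.univ.filter P, (choiceMeasure δ n).real (E S) ≤ 1 := by
    rw [← measureReal_biUnion_finset (fun S _ S' _ hSS => ?_) fun S _ => hmeas S]
    · exact measureReal_le_one
    · rw [Function.onFun, Set.disjoint_left]
      exact fun ω h1 h2 => hSS (h1.symm.trans h2)
  calc _ ≤ (choiceMeasure δ n).real (⋃ S ∈ Finset.univ.filter P, E S ∩ D S) :=
        measureReal_mono hsub (measure_ne_top _ _)
    _ ≤ ∑ S ∈ Finset.univ.filter P, (choiceMeasure δ n).real (E S ∩ D S) :=
        measureReal_biUnion_finset_le _ _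
    _ ≤ ∑ S ∈ Finset.univ.filter P, (choiceMeasure δ n).real (E S) * p := by
        refine Finset.sum_le_sum fun S hS => ?_
        rw [hmul]
        exact mul_le_mul_of_nonneg_left (h S (Finset.mem_filter.mp hS).2) measureReal_nonneg
    _ ≤ 1 * p := by
        rw [← Finset.sum_mul]
        exact mul_le_mul_of_nonneg_right hone hp
    _ = p := one_mul p

/-- Within a stage, the number of active stations stays below the window size with high
probability. -/
theorem measureReal_active_gt_le (h0 : 0 < δ) (h1 : δ < 1 / Real.exp 1) (A : Finset (Fin n))
    {r m : ℕ} {w : ℝ} (hw : 0 < w) (hA : (A.card : ℝ) ≤ w)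
    (hst : ∀ j < m, (loopState δ (r + j)).2 = w * (1 - δ) ^ j) :
    (choiceMeasure δ n).real
        {ω | w * (1 - δ) ^ m < ((activeAfter A ω (roundStart δ (r + m))).card : ℝ)} ≤
      2 / (1 / Real.exp 1 - δ) ^ 2 * ((1 - δ) / (w * (1 - δ) ^ m * δ)) := by
  have hδ1 : δ < 1 := h1.trans_le (by
    rw [div_le_one (Real.exp_pos _)]
    exact Real.one_le_exp (by norm_num))
  have hq : 0 < 1 - δ := by linarith
  induction m with
  | zero =>
    have : {ω : Choices δ n |
        w * (1 - δ) ^ 0 < ((activeAfter A ω (roundStart δ (r + 0))).card : ℝ)} = ∅ := by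
      refine Set.eq_empty_of_forall_notMem fun ω hω => ?_
      rw [Set.mem_ofPred_eq, pow_zero, mul_one] at hω
      have : ((activeAfter A ω (roundStart δ (r + 0))).card : ℝ) ≤ A.card := by
        exact_mod_cast Finset.card_le_card (activeAfter_subset A ω _)
      linarith
    rw [this, measureReal_empty]
    positivity
  | succ m ih =>
    have ih := ih fun j hj => hst j (by omega)
    set wm := w * (1 - δ) ^ m with hwm
    have hwm0 : 0 < wm := by positivity
    have hwm' : w * (1 - δ) ^ (m + 1) = wm * (1 - δ) := by rw [hwm, pow_succ, mul_assoc]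
    rw [hwm']
    have hlen : windowLength δ (r + m) = ⌊wm⌋₊ := by
      rw [windowLength, hst m (by omega)]
    have hstep := measureReal_round_le (δ := δ) A (r + m) (fun S => (S.card : ℝ) ≤ wm)
      (fun S => wm * (1 - δ) < (S.card : ℝ)) (p := 2 / (1 / Real.exp 1 - δ) ^ 2 / wm)
      (by positivity) fun S hS => by
        refine measureReal_card_colliding_gt_le (iIndepFun_choice (r + m))
          (fun v => measurable_choice v _) (fun v s => measureReal_choice v _ s)
          (windowLength_pos _ _) ?_ h1 ?_
        · rw [hlen]
          exact Nat.le_floor hS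
        · rw [hlen]
          exact Nat.floor_le hwm0.le
    have hsub : {ω : Choices δ n |
        wm * (1 - δ) < ((activeAfter A ω (roundStart δ (r + (m + 1)))).card : ℝ)} ⊆
        {ω | wm < ((activeAfter A ω (roundStart δ (r + m))).card : ℝ)} ∪
        {ω | ((activeAfter A ω (roundStart δ (r + m))).card : ℝ) ≤ wm ∧
          wm * (1 - δ) < ((activeAfter A ω (roundStart δ (r + m + 1))).card : ℝ)} := by
      intro ω hω
      rcases lt_or_ge wm ((activeAfter A ω (roundStart δ (r + m))).card : ℝ) with h | h
      · exact Or.inl h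
      · exact Or.inr ⟨h, hω⟩
    refine (measureReal_mono hsub (measure_ne_top _ _)).trans
      ((measureReal_union_le _ _).trans ((add_le_add ih hstep).trans (le_of_eq ?_)))
    -- The bound is shaped so that the induction closes with equality: `(1 - δ)/(wm * δ) + 1/wm =
    -- 1/(wm * δ)`, which is the next bound since `1 - δ` cancels.
    have hε : 1 / Real.exp 1 - δ ≠ 0 := by linarith
    generalize 2 / (1 / Real.exp 1 - δ) ^ 2 = C
    field_simp
    ring

theorem measureReal_last_window_le (A : Finset (Fin n)) (r : ℕ) (x : ℝ) :
    (choiceMeasure δ n).real {ω | ((activeAfter A ω (roundStart δ r)).card : ℝ) ≤ x ∧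
      activeAfter A ω (roundStart δ (r + 1)) ≠ ∅} ≤ x ^ 2 / windowLength δ r := by
  refine measureReal_round_le A r (fun S => (S.card : ℝ) ≤ x) (fun S => S ≠ ∅) (by positivity)
    fun S hS => ?_
  refine (measureReal_colliding_nonempty_le (iIndepFun_choice r)
    (fun v => measurable_choice v _) (fun v s => measureReal_choice v _ s)
    (windowLength_pos _ _) S).trans ?_
  gcongr

/-- A bound for the failure probability in which the number of active stations is required to
drop to `x`, for any threshold `x`. -/
theorem measureReal_not_solvedWithin_le (h0 : 0 < δ) (h1 : δ < 1 / Real.exp 1)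
    (A : Finset (Fin n)) {x : ℝ} (hx1 : 1 ≤ x) (hxk : x ≤ A.card) :
    (choiceMeasure δ n).real {ω | ¬ SolvedWithin A ω (4 * (1 + 1 / δ) * (A.card : ℝ))} ≤
      2 / (1 / Real.exp 1 - δ) ^ 2 / (x * δ) + x ^ 2 / (2 * A.card) := by
  have hδ1 : δ < 1 := h1.trans_le (by
    rw [div_le_one (Real.exp_pos _)]
    exact Real.one_le_exp (by norm_num))
  have hq : 0 < 1 - δ := by linarith
  set k := A.card with hk
  have hk1 : 1 ≤ k := by exact_mod_cast hx1.trans hxk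
  -- This stage has `k < 2 ^ (i + 1) ≤ 2k`: large enough for the invariant to hold at its start with
  -- no assumption on earlier rounds, small enough for the time budget.
  obtain ⟨i, hi⟩ : ∃ i, Nat.log 2 (2 * k) = i + 1 := by
    have : 0 < Nat.log 2 (2 * k) := Nat.log_pos (by norm_num) (by omega)
    exact ⟨_, (Nat.succ_pred_eq_of_pos this).symm⟩
  have hle : (2 : ℝ) ^ (i + 1) ≤ 2 * k := by
    rw [← hi]
    exact_mod_cast Nat.pow_log_le_self 2 (by omega : 2 * k ≠ 0)
  have hlt : (2 : ℝ) * k < 2 ^ (i + 1 + 1) := by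
    rw [← hi]
    exact_mod_cast Nat.lt_pow_succ_log_self (b := 2) (by norm_num) (2 * k)
  have hkw : (k : ℝ) < 2 ^ (i + 1) := by
    rw [pow_succ] at hlt
    linarith
  obtain ⟨r, hr, hrs⟩ := exists_stage_start h0 hδ1 i
  obtain ⟨m, hm, hm', hnext, hnexts⟩ := exists_next_stage h0 hδ1 hr
  have hex : ∃ j, (2 : ℝ) ^ (i + 1) * (1 - δ) ^ j < x := ⟨m + 1, hm'.trans_le hx1⟩
  classical
  -- Exponent `j + 1` is the first to bring the size below `x`, so windows up to exponent `j` have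
  -- size at least `x` and lie in the stage; exponent `0` is excluded by `x ≤ k < 2 ^ (i + 1)`.
  obtain ⟨j, hj⟩ : ∃ j, Nat.find hex = j + 1 := by
    refine Nat.exists_eq_succ_of_ne_zero fun h => ?_
    have := Nat.find_spec hex
    rw [h, pow_zero, mul_one] at this
    linarith
  have hjx : (2 : ℝ) ^ (i + 1) * (1 - δ) ^ (j + 1) < x := hj ▸ Nat.find_spec hex
  have hxj : x ≤ (2 : ℝ) ^ (i + 1) * (1 - δ) ^ j :=
    not_lt.mp (Nat.find_min hex (by omega))
  have hjm : j + 1 ≤ m + 1 := hj ▸ Nat.find_min' hex (hm'.trans_le hx1)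
  have hbound := measureReal_active_gt_le (n := n) h0 h1 A (r := r) (m := j + 1)
    (w := 2 ^ (i + 1)) (by positivity) hkw.le fun l hl => by
      rw [loopState_add hr fun l' hl' => hm l' (by omega)]
  have hlast := measureReal_last_window_le (δ := δ) A (r + (m + 1)) x
  have hlen : windowLength δ (r + (m + 1)) = 2 ^ (i + 1 + 1) := by
    rw [windowLength, hnext]
    exact_mod_cast Nat.floor_natCast (R := ℝ) (2 ^ (i + 1 + 1))
  have hsub : {ω : Choices δ n | ¬ SolvedWithin A ω (4 * (1 + 1 / δ) * (k : ℝ))} ⊆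
      {ω | (2 : ℝ) ^ (i + 1) * (1 - δ) ^ (j + 1) <
        ((activeAfter A ω (roundStart δ (r + (j + 1)))).card : ℝ)} ∪
      {ω | ((activeAfter A ω (roundStart δ (r + (m + 1)))).card : ℝ) ≤ x ∧
        activeAfter A ω (roundStart δ (r + (m + 1) + 1)) ≠ ∅} := by
    intro ω hω
    by_contra hcon
    rw [Set.mem_union, not_or] at hcon
    obtain ⟨hc1, hc2⟩ := hcon
    rw [Set.mem_ofPred_eq, not_lt] at hc1
    rw [Set.mem_ofPred_eq, not_and_not_right] at hc2
    -- For the remaining windows of the stage it suffices that the active set never grows.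
    have hmono : ((activeAfter A ω (roundStart δ (r + (m + 1)))).card : ℝ) ≤
        (activeAfter A ω (roundStart δ (r + (j + 1)))).card := by
      exact_mod_cast Finset.card_le_card
        (activeAfter_antitone A ω (roundStart_mono δ (by omega)))
    refine hω ⟨_, ?_, hc2 (by linarith)⟩
    rw [roundStart_succ, hlen]
    push_cast
    have h2 : (2 : ℝ) ^ (i + 1) / δ ≤ 2 * k / δ := by gcongr
    have h3 : 4 * (1 + 1 / δ) * (k : ℝ) = 2 * k / δ + 2 * k / δ + 4 * k := by
      field_simp
      ring
    rw [h3, pow_succ _ (i + 1)]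
    linarith
  refine (measureReal_mono hsub (measure_ne_top _ _)).trans
    ((measureReal_union_le _ _).trans (add_le_add (hbound.trans ?_) (hlast.trans ?_)))
  · have he : (1 - δ) / ((2 : ℝ) ^ (i + 1) * (1 - δ) ^ (j + 1) * δ) =
        1 / ((2 : ℝ) ^ (i + 1) * (1 - δ) ^ j * δ) := by
      rw [pow_succ _ j]
      field_simp
    rw [he, mul_one_div]
    gcongr
  · rw [hlen]
    push_cast
    have : (0 : ℝ) < k := by exact_mod_cast hk1
    gcongr

end ChoiceMeasure

end ExpBackoff

theorem mainTheorem2 (δ : ℝ) (hδ_pos : 0 < δ) (hδ_lt : δ < 1 / Real.exp 1) :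
    ∃ c : ℝ, 0 < c ∧ ∃ K : ℕ, ∀ k : ℕ, K ≤ k →
      ∀ (n : ℕ) (A : Finset (Fin n)), A.card = k →
        1 - 1 / (k : ℝ) ^ c ≤
          (ExpBackoff.choiceMeasure δ n).real
            {ω | ExpBackoff.SolvedWithin A ω (4 * (1 + 1 / δ) * (k : ℝ))} := by
  set C : ℝ := 2 / (1 / Real.exp 1 - δ) ^ 2 / δ with hC
  have hlim : Filter.Tendsto (fun k : ℕ => (k : ℝ) ^ (1 / 8 : ℝ)) Filter.atTop Filter.atTop :=
    (tendsto_rpow_atTop (by norm_num)).comp tendsto_natCast_atTop_atTop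
  -- With `y = k^(1/8)` and threshold `x = y²`, the two failure terms are `C/y²` and at most `1/y²`;
  -- `C + 1 ≤ y` brings their sum below `1/y`, hence `c = 1/8`.
  obtain ⟨K, hK⟩ := Filter.eventually_atTop.mp (hlim.eventually_ge_atTop (C + 1))
  refine ⟨1 / 8, by norm_num, K + 1, fun k hk n A hA => ?_⟩
  subst hA
  set y : ℝ := (A.card : ℝ) ^ (1 / 8 : ℝ) with hy
  have hyC : C + 1 ≤ y := hK _ (by omega)
  have hk1 : (1 : ℝ) ≤ A.card := by exact_mod_cast (by omega : 1 ≤ A.card)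
  have hy1 : 1 ≤ y := Real.one_le_rpow hk1 (by norm_num)
  have hy8 : (A.card : ℝ) = y ^ 8 := by
    rw [hy, ← Real.rpow_natCast, ← Real.rpow_mul (by linarith)]
    norm_num
  have hfail := ExpBackoff.measureReal_not_solvedWithin_le (δ := δ) hδ_pos hδ_lt A (x := y ^ 2)
    (one_le_pow₀ hy1) (by rw [hy8]; exact pow_le_pow_right₀ hy1 (by norm_num))
  have hy0 : 0 < y := by linarith
  clear_value y C
  have hle : 2 / (1 / Real.exp 1 - δ) ^ 2 / (y ^ 2 * δ) + (y ^ 2) ^ 2 / (2 * A.card) ≤ 1 / y := by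
    have h1 : 2 / (1 / Real.exp 1 - δ) ^ 2 / (y ^ 2 * δ) = C / y ^ 2 := by
      rw [hC, mul_comm, ← div_div]
    have h2 : (y ^ 2) ^ 2 / (2 * A.card) ≤ 1 / y ^ 2 := by
      rw [hy8, div_le_div_iff₀ (by positivity) (by positivity)]
      have := pow_le_pow_right₀ hy1 (show 6 ≤ 8 by norm_num)
      have : 0 < y ^ 8 := by positivity
      nlinarith
    calc _ ≤ C / y ^ 2 + 1 / y ^ 2 := by rw [h1]; gcongr
      _ = (C + 1) / y ^ 2 := by ring
      _ ≤ y / y ^ 2 := by gcongr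
      _ = 1 / y := by field_simp
  -- Subadditivity is enough here and avoids proving the success event measurable.
  have hcover : (1 : ℝ) ≤
      (ExpBackoff.choiceMeasure δ n).real
        {ω | ExpBackoff.SolvedWithin A ω (4 * (1 + 1 / δ) * (A.card : ℝ))} +
      (ExpBackoff.choiceMeasure δ n).real
        {ω | ¬ ExpBackoff.SolvedWithin A ω (4 * (1 + 1 / δ) * (A.card : ℝ))} := by
    rw [← probReal_univ (μ := ExpBackoff.choiceMeasure δ n)]
    refine le_trans (measureReal_mono ?_ (measure_ne_top _ _)) (measureReal_union_le _ _)
    exact fun ω _ => em _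
  linarith
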